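/- Let $n$ be a nonnegative integer, let $1<p\le 2$ and $r\ge 1$ be real numbers, and let $B$ be any complex $n\times n$ matrix (not necessarily invertible). For a positive semidefinite complex matrix $X$ and a real number $t>0$, let $X^{t}$ denote the positive semidefinite matrix obtained by applying $x\mapsto x^{t}$ to the eigenvalues of $X$. Then the map $$A\mapsto \operatorname{tr}\big[(B^{*}A^{p}B)^{r/p}\big]$$ is convex on the convex set of positive definite Hermitian $n\times n$ complex matrices. -/

import Mathlib

open scoped MatrixOrder ComplexOrder

/-! The core is the joint convexity of `(A, Z) ↦ tr (Kᴴ A^p K Z^(1-p))`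
(`trace_rpow_mul_rpow_convex`). In eigenbases of `A` and `Z` this trace is a weighted sum of `x^p
z^(1-p)`, an integral of kernels `x²/(x + tz)` (for `p = 2` it is `x²/z`). Each kernel sum is a
maximum over `W` of functionals linear in `(A, Z)`, hence convex.

Put `X = Bᴴ A^p B` and `σ = r/p`. If `r < p`, Young's inequality gives `tr X^σ = inf_Z [σ tr (X
Z^(1-p)) + (1-σ) tr Z^c]` with `c ≥ 1`; the bracket is jointly convex in `(A, Z)`, and partial
minimisation preserves convexity. If `r ≥ p`, the case `Z = 1` makes `X` operator convex in `A`, and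
`tr X^σ` with `σ ≥ 1` is monotone and convex in `X` by Peierls' inequality. -/

namespace Matrix

/-! ### Traces in a pair of eigenbases -/

variable {ι : Type*} [Fintype ι] [DecidableEq ι]

/-- The matrix `K` expressed in the eigenbases of two Hermitian matrices. -/
noncomputable def eigenCoeff {A Z : Matrix ι ι ℂ} (hA : A.IsHermitian) (hZ : Z.IsHermitian)
    (K : Matrix ι ι ℂ) : Matrix ι ι ℂ :=
  star (hA.eigenvectorUnitary : Matrix ι ι ℂ) * K * (hZ.eigenvectorUnitary : Matrix ι ι ℂ)

lemma IsHermitian.cfc_eq_mul {A : Matrix ι ι ℂ} (hA : A.IsHermitian) (f : ℝ → ℝ) :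
    cfc f A = (hA.eigenvectorUnitary : Matrix ι ι ℂ) *
      diagonal (fun i => (f (hA.eigenvalues i) : ℂ)) *
        star (hA.eigenvectorUnitary : Matrix ι ι ℂ) := by
  rw [hA.cfc_eq, IsHermitian.cfc, Unitary.conjStarAlgAut_apply]
  rfl

lemma trace_cfc {A : Matrix ι ι ℂ} (hA : A.IsHermitian) (f : ℝ → ℝ) :
    (trace (cfc f A)).re = ∑ i, f (hA.eigenvalues i) := by
  rw [hA.cfc_eq_mul, trace_mul_comm, ← mul_assoc]
  simp [trace_diagonal]

lemma trace_conjTranspose_mul_cfc {A Z : Matrix ι ι ℂ} (hA : A.IsHermitian) (hZ : Z.IsHermitian)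
    (W K : Matrix ι ι ℂ) (f g : ℝ → ℝ) :
    trace (Wᴴ * cfc f A * K * cfc g Z) =
      ∑ i, ∑ j, star (eigenCoeff hA hZ W i j) * eigenCoeff hA hZ K i j *
        ((f (hA.eigenvalues i) * g (hZ.eigenvalues j) : ℝ) : ℂ) := by
  have h : trace (Wᴴ * cfc f A * K * cfc g Z) =
      trace ((eigenCoeff hA hZ W)ᴴ * (diagonal (fun i => (f (hA.eigenvalues i) : ℂ)) *
        (eigenCoeff hA hZ K * diagonal (fun j => (g (hZ.eigenvalues j) : ℂ))))) := by
    rw [hA.cfc_eq_mul, hZ.cfc_eq_mul, ← mul_assoc, trace_mul_comm]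
    simp only [eigenCoeff, conjTranspose_mul, star_eq_conjTranspose, conjTranspose_conjTranspose,
      mul_assoc]
  rw [h, trace, Finset.sum_comm]
  refine Finset.sum_congr rfl fun j _ => ?_
  rw [diag_apply, mul_apply]
  refine Finset.sum_congr rfl fun i _ => ?_
  rw [diagonal_mul, mul_diagonal, conjTranspose_apply]
  push_cast
  ring

lemma trace_conjTranspose_mul_cfc_self {A Z : Matrix ι ι ℂ} (hA : A.IsHermitian)
    (hZ : Z.IsHermitian) (K : Matrix ι ι ℂ) (f g : ℝ → ℝ) :
    (trace (Kᴴ * cfc f A * K * cfc g Z)).re =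
      ∑ i, ∑ j, ‖eigenCoeff hA hZ K i j‖ ^ 2 *
        (f (hA.eigenvalues i) * g (hZ.eigenvalues j)) := by
  rw [trace_conjTranspose_mul_cfc hA hZ, Complex.re_sum]
  refine Finset.sum_congr rfl fun i _ => ?_
  rw [Complex.re_sum]
  refine Finset.sum_congr rfl fun j _ => ?_
  rw [Complex.star_def, mul_comm (starRingEnd ℂ _), Complex.mul_conj, Complex.normSq_eq_norm_sq,
    ← Complex.ofReal_mul, Complex.ofReal_re]

/-! ### Joint convexity of the trace functional -/

/-- The real-linear functional of `(A, Z)` whose supremum over `W` is the quadratic form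
`∑ |K i j|² a i² / (α a i + β z j)`. -/
noncomputable def quadForm (α β : ℝ) (K W A Z : Matrix ι ι ℂ) : ℝ :=
  2 * (trace (Wᴴ * A * K)).re - α * (trace (Wᴴ * A * W)).re - β * (trace (Wᴴ * W * Z)).re

lemma quadForm_add_smul (α β s t : ℝ) (K W A₁ A₂ Z₁ Z₂ : Matrix ι ι ℂ) :
    quadForm α β K W (s • A₁ + t • A₂) (s • Z₁ + t • Z₂) =
      s * quadForm α β K W A₁ Z₁ + t * quadForm α β K W A₂ Z₂ := by
  simp only [quadForm, mul_add, add_mul, mul_smul_comm, smul_mul_assoc, trace_add, trace_smul,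
    Complex.add_re, Complex.smul_re, smul_eq_mul]
  ring

lemma quadForm_eq_sum (α β : ℝ) (K W : Matrix ι ι ℂ) {A Z : Matrix ι ι ℂ} (hA : A.IsHermitian)
    (hZ : Z.IsHermitian) :
    quadForm α β K W A Z = ∑ i, ∑ j,
      (2 * (star (eigenCoeff hA hZ W i j) * eigenCoeff hA hZ K i j).re * hA.eigenvalues i -
        (α * hA.eigenvalues i + β * hZ.eigenvalues j) * ‖eigenCoeff hA hZ W i j‖ ^ 2) := by
  have e1 : (trace (Wᴴ * A * K)).re = ∑ i, ∑ j,
      (star (eigenCoeff hA hZ W i j) * eigenCoeff hA hZ K i j).re * hA.eigenvalues i := by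
    have h := trace_conjTranspose_mul_cfc hA hZ W K id (fun _ => 1)
    rw [cfc_id ℝ A hA.isSelfAdjoint, cfc_const_one ℝ Z hZ.isSelfAdjoint, mul_one] at h
    rw [h]
    simp only [Complex.re_sum, id, mul_one, Complex.re_mul_ofReal]
  have e2 : (trace (Wᴴ * A * W)).re = ∑ i, ∑ j,
      ‖eigenCoeff hA hZ W i j‖ ^ 2 * hA.eigenvalues i := by
    have h := trace_conjTranspose_mul_cfc_self hA hZ W id (fun _ => 1)
    rw [cfc_id ℝ A hA.isSelfAdjoint, cfc_const_one ℝ Z hZ.isSelfAdjoint, mul_one] at h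
    simpa using h
  have e3 : (trace (Wᴴ * W * Z)).re = ∑ i, ∑ j,
      ‖eigenCoeff hA hZ W i j‖ ^ 2 * hZ.eigenvalues j := by
    have h := trace_conjTranspose_mul_cfc_self hA hZ W (fun _ => 1) id
    rw [cfc_id ℝ Z hZ.isSelfAdjoint, cfc_const_one ℝ A hA.isSelfAdjoint, mul_one] at h
    simpa using h
  rw [quadForm, e1, e2, e3]
  simp only [Finset.mul_sum, ← Finset.sum_sub_distrib]
  refine Finset.sum_congr rfl fun i _ => Finset.sum_congr rfl fun j _ => ?_
  ring

lemma exists_eigenCoeff_eq {A Z : Matrix ι ι ℂ} (hA : A.IsHermitian) (hZ : Z.IsHermitian)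
    (w : Matrix ι ι ℂ) : ∃ W, eigenCoeff hA hZ W = w := by
  refine ⟨(hA.eigenvectorUnitary : Matrix ι ι ℂ) * w *
    star (hZ.eigenvectorUnitary : Matrix ι ι ℂ), ?_⟩
  have h1 := Unitary.coe_star_mul_self hA.eigenvectorUnitary
  have h2 := Unitary.coe_star_mul_self hZ.eigenvectorUnitary
  rw [eigenCoeff, mul_assoc, mul_assoc, mul_assoc, h2, mul_one, ← mul_assoc, h1, one_mul]

/-- The sum `∑ |K i j|² h (a i) (z j)` over a pair of eigenbases. -/
noncomputable def eigenSum (h : ℝ → ℝ → ℝ) {A Z : Matrix ι ι ℂ} (hA : A.IsHermitian)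
    (hZ : Z.IsHermitian) (K : Matrix ι ι ℂ) : ℝ :=
  ∑ i, ∑ j, ‖eigenCoeff hA hZ K i j‖ ^ 2 * h (hA.eigenvalues i) (hZ.eigenvalues j)

lemma quadForm_le_eigenSum {α β : ℝ} (K W : Matrix ι ι ℂ) {A Z : Matrix ι ι ℂ}
    (hA : A.IsHermitian) (hZ : Z.IsHermitian)
    (hpos : ∀ i j, 0 < α * hA.eigenvalues i + β * hZ.eigenvalues j) :
    quadForm α β K W A Z ≤ eigenSum (fun x z => x ^ 2 / (α * x + β * z)) hA hZ K := by
  rw [quadForm_eq_sum α β K W hA hZ, eigenSum]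
  refine Finset.sum_le_sum fun i _ => Finset.sum_le_sum fun j _ => ?_
  have hy := hpos i j
  set y := α * hA.eigenvalues i + β * hZ.eigenvalues j
  set a := hA.eigenvalues i
  set k := eigenCoeff hA hZ K i j
  set w := eigenCoeff hA hZ W i j
  rw [← mul_div_assoc, le_div_iff₀ hy, ← Complex.normSq_eq_norm_sq, ← Complex.normSq_eq_norm_sq,
    Complex.normSq_apply, Complex.normSq_apply]
  simp only [Complex.star_def, Complex.mul_re, Complex.conj_re, Complex.conj_im]
  -- Completing the square: `|y w - a k|² ≥ 0`, split into real and imaginary parts.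
  nlinarith [sq_nonneg (y * w.re - a * k.re), sq_nonneg (y * w.im - a * k.im)]

lemma exists_quadForm_eq_eigenSum {α β : ℝ} (K : Matrix ι ι ℂ) {A Z : Matrix ι ι ℂ}
    (hA : A.IsHermitian) (hZ : Z.IsHermitian)
    (hpos : ∀ i j, 0 < α * hA.eigenvalues i + β * hZ.eigenvalues j) :
    ∃ W, quadForm α β K W A Z = eigenSum (fun x z => x ^ 2 / (α * x + β * z)) hA hZ K := by
  -- The maximiser makes that square vanish: `w = a k / (α a + β z)` entrywise.
  obtain ⟨W, hW⟩ := exists_eigenCoeff_eq hA hZ (Matrix.of fun i j =>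
    ((hA.eigenvalues i / (α * hA.eigenvalues i + β * hZ.eigenvalues j) : ℝ) : ℂ) *
      eigenCoeff hA hZ K i j)
  refine ⟨W, ?_⟩
  rw [quadForm_eq_sum α β K W hA hZ, eigenSum]
  refine Finset.sum_congr rfl fun i _ => Finset.sum_congr rfl fun j _ => ?_
  have hy := (hpos i j).ne'
  rw [hW, of_apply]
  set y := α * hA.eigenvalues i + β * hZ.eigenvalues j
  set a := hA.eigenvalues i
  set k := eigenCoeff hA hZ K i j
  rw [← Complex.normSq_eq_norm_sq, ← Complex.normSq_eq_norm_sq,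
    Complex.normSq_apply, Complex.normSq_apply]
  simp only [Complex.star_def, Complex.mul_re, Complex.mul_im, Complex.conj_re, Complex.conj_im,
    Complex.ofReal_re, Complex.ofReal_im]
  field_simp
  ring

/-- A maximum of linear functionals is convex: the `W` optimal at the combination is only a
competitor at the two endpoints. Allowing `α = 0` covers the kernel `x²/z`. -/
lemma eigenSum_div_convex {α β s t : ℝ} (hα : 0 ≤ α) (hβ : 0 ≤ β) (hαβ : 0 < α + β) (hs : 0 ≤ s)
    (ht : 0 ≤ t) (K : Matrix ι ι ℂ) {A₁ A₂ Z₁ Z₂ : Matrix ι ι ℂ} (hA₁ : A₁.PosDef)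
    (hA₂ : A₂.PosDef) (hZ₁ : Z₁.PosDef) (hZ₂ : Z₂.PosDef) (hA : (s • A₁ + t • A₂).PosDef)
    (hZ : (s • Z₁ + t • Z₂).PosDef) :
    eigenSum (fun x z => x ^ 2 / (α * x + β * z)) hA.isHermitian hZ.isHermitian K ≤
      s * eigenSum (fun x z => x ^ 2 / (α * x + β * z)) hA₁.isHermitian hZ₁.isHermitian K +
      t * eigenSum (fun x z => x ^ 2 / (α * x + β * z)) hA₂.isHermitian hZ₂.isHermitian K := by
  have pos : ∀ x z : ℝ, 0 < x → 0 < z → 0 < α * x + β * z := by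
    intro x z hx hz
    rcases hα.eq_or_lt with h | h
    · subst h
      have : 0 < β := by linarith
      simp; positivity
    · positivity
  obtain ⟨W, hW⟩ := exists_quadForm_eq_eigenSum (α := α) (β := β) K hA.isHermitian hZ.isHermitian
    fun i j => pos _ _ (hA.eigenvalues_pos i) (hZ.eigenvalues_pos j)
  rw [← hW, quadForm_add_smul]
  gcongr
  · exact quadForm_le_eigenSum K W _ _
      fun i j => pos _ _ (hA₁.eigenvalues_pos i) (hZ₁.eigenvalues_pos j)
  · exact quadForm_le_eigenSum K W _ _
      fun i j => pos _ _ (hA₂.eigenvalues_pos i) (hZ₂.eigenvalues_pos j)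

/-- The perspective of the integral representation of `u ↦ u^p`: evaluate at `u = x/z` and multiply
by `z`. The measure does not depend on `x` or `z`. -/
lemma exists_measure_rpow_mul_rpow_eq_integral {p : ℝ} (hp : p ∈ Set.Ioo 1 2) :
    ∃ μ : MeasureTheory.Measure ℝ, ∀ x z : ℝ, 0 < x → 0 < z →
      MeasureTheory.IntegrableOn (fun t => t ^ (p - 2) * (x ^ 2 / (1 * x + t * z)))
        (Set.Ioi 0) μ ∧
      x ^ p * z ^ (1 - p) =
        ∫ t in Set.Ioi 0, t ^ (p - 2) * (x ^ 2 / (1 * x + t * z)) ∂μ := by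
  obtain ⟨μ, hμ⟩ := Real.exists_measure_rpow_eq_integral_rpowIntegrand₁₂ hp
  refine ⟨μ, fun x z hx hz => ?_⟩
  obtain ⟨hi, he⟩ := hμ (x / z) (Set.mem_Ici.2 (by positivity))
  have key : Set.EqOn (fun t => z * Real.rpowIntegrand₁₂ p t (x / z))
      (fun t => t ^ (p - 2) * (x ^ 2 / (1 * x + t * z))) (Set.Ioi 0) := by
    intro t ht
    have ht : 0 < t := ht
    have h : t ^ (p - 1) = t ^ (p - 2) * t := by
      rw [← Real.rpow_add_one ht.ne']; ring_nf
    simp only [Real.rpowIntegrand₁₂, h]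
    field_simp
    ring
  constructor
  · exact (MeasureTheory.IntegrableOn.congr_fun (hi.const_mul z) key measurableSet_Ioi)
  · rw [← MeasureTheory.setIntegral_congr_fun measurableSet_Ioi key,
      MeasureTheory.integral_const_mul, ← he, Real.div_rpow hx.le hz.le, Real.rpow_sub hz,
      Real.rpow_one]
    field_simp

lemma eigenSum_rpow_convex {p s t : ℝ} (hp : 1 < p) (hp' : p ≤ 2) (hs : 0 ≤ s)
    (ht : 0 ≤ t) (K : Matrix ι ι ℂ) {A₁ A₂ Z₁ Z₂ : Matrix ι ι ℂ} (hA₁ : A₁.PosDef)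
    (hA₂ : A₂.PosDef) (hZ₁ : Z₁.PosDef) (hZ₂ : Z₂.PosDef) (hA : (s • A₁ + t • A₂).PosDef)
    (hZ : (s • Z₁ + t • Z₂).PosDef) :
    eigenSum (fun x z => x ^ p * z ^ (1 - p)) hA.isHermitian hZ.isHermitian K ≤
      s * eigenSum (fun x z => x ^ p * z ^ (1 - p)) hA₁.isHermitian hZ₁.isHermitian K +
      t * eigenSum (fun x z => x ^ p * z ^ (1 - p)) hA₂.isHermitian hZ₂.isHermitian K := by
  -- The integral representation needs `p < 2`; at the endpoint the function is itself a kernel.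
  rcases hp'.eq_or_lt with rfl | hp'
  · have h := eigenSum_div_convex (α := 0) (β := 1) le_rfl zero_le_one (by norm_num) hs ht K
      hA₁ hA₂ hZ₁ hZ₂ hA hZ
    have e : (fun x z : ℝ => x ^ (2 : ℝ) * z ^ (1 - 2 : ℝ)) =
        fun x z => x ^ 2 / (0 * x + 1 * z) := by
      funext x z
      norm_num [Real.rpow_neg_one, div_eq_mul_inv]
    rw [e]
    exact h
  · obtain ⟨μ, hμ⟩ := exists_measure_rpow_mul_rpow_eq_integral ⟨hp, hp'⟩
    have key : ∀ {A Z : Matrix ι ι ℂ} (hA : A.PosDef) (hZ : Z.PosDef),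
        MeasureTheory.IntegrableOn (fun u => u ^ (p - 2) *
          eigenSum (fun x z => x ^ 2 / (1 * x + u * z)) hA.isHermitian hZ.isHermitian K)
          (Set.Ioi 0) μ ∧
        eigenSum (fun x z => x ^ p * z ^ (1 - p)) hA.isHermitian hZ.isHermitian K =
        ∫ u in Set.Ioi 0, u ^ (p - 2) *
          eigenSum (fun x z => x ^ 2 / (1 * x + u * z)) hA.isHermitian hZ.isHermitian K ∂μ := by
      intro A Z hA hZ
      have e : (fun u : ℝ => u ^ (p - 2) *
          eigenSum (fun x z => x ^ 2 / (1 * x + u * z)) hA.isHermitian hZ.isHermitian K) =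
          fun u => ∑ i, ∑ j, ‖eigenCoeff hA.isHermitian hZ.isHermitian K i j‖ ^ 2 *
            (u ^ (p - 2) * (hA.isHermitian.eigenvalues i ^ 2 /
              (1 * hA.isHermitian.eigenvalues i + u * hZ.isHermitian.eigenvalues j))) := by
        funext u
        simp only [eigenSum, Finset.mul_sum]
        refine Finset.sum_congr rfl fun i _ => Finset.sum_congr rfl fun j _ => ?_
        ring
      have hint := fun i j => hμ _ _ (hA.eigenvalues_pos i) (hZ.eigenvalues_pos j)
      rw [e]
      constructor
      · exact MeasureTheory.integrable_finsetSum _ fun i _ =>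
          MeasureTheory.integrable_finsetSum _ fun j _ => (hint i j).1.const_mul _
      · rw [MeasureTheory.integral_finsetSum _ fun i _ =>
          MeasureTheory.integrable_finsetSum _ fun j _ => (hint i j).1.const_mul _]
        refine Finset.sum_congr rfl fun i _ => ?_
        rw [MeasureTheory.integral_finsetSum _ fun j _ => (hint i j).1.const_mul _]
        refine Finset.sum_congr rfl fun j _ => ?_
        rw [MeasureTheory.integral_const_mul, ← (hint i j).2]
    rw [(key hA hZ).2, (key hA₁ hZ₁).2, (key hA₂ hZ₂).2, ← MeasureTheory.integral_const_mul,
      ← MeasureTheory.integral_const_mul, ← MeasureTheory.integral_add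
        ((key hA₁ hZ₁).1.const_mul _) ((key hA₂ hZ₂).1.const_mul _)]
    refine MeasureTheory.setIntegral_mono_on (key hA hZ).1
      (((key hA₁ hZ₁).1.const_mul _).add ((key hA₂ hZ₂).1.const_mul _)) measurableSet_Ioi ?_
    intro u hu
    have hu : 0 < u := hu
    have h := mul_le_mul_of_nonneg_left (eigenSum_div_convex (α := 1) (β := u) zero_le_one hu.le
      (by positivity) hs ht K hA₁ hA₂ hZ₁ hZ₂ hA hZ) (Real.rpow_nonneg hu.le (p - 2))
    refine h.trans_eq ?_
    ring

/-- Joint convexity of `(A, Z) ↦ tr (Kᴴ A ^ p K Z ^ (1 - p))` for `1 < p ≤ 2`. -/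
theorem trace_rpow_mul_rpow_convex {p s t : ℝ} (hp : 1 < p) (hp' : p ≤ 2) (hs : 0 ≤ s)
    (ht : 0 ≤ t) (K : Matrix ι ι ℂ) {A₁ A₂ Z₁ Z₂ : Matrix ι ι ℂ} (hA₁ : A₁.PosDef)
    (hA₂ : A₂.PosDef) (hZ₁ : Z₁.PosDef) (hZ₂ : Z₂.PosDef) (hA : (s • A₁ + t • A₂).PosDef)
    (hZ : (s • Z₁ + t • Z₂).PosDef) :
    (trace (Kᴴ * (s • A₁ + t • A₂) ^ p * K * (s • Z₁ + t • Z₂) ^ (1 - p))).re ≤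
      s * (trace (Kᴴ * A₁ ^ p * K * Z₁ ^ (1 - p))).re +
      t * (trace (Kᴴ * A₂ ^ p * K * Z₂ ^ (1 - p))).re := by
  have key : ∀ {A Z : Matrix ι ι ℂ} (hA : A.PosDef) (hZ : Z.PosDef),
      (trace (Kᴴ * A ^ p * K * Z ^ (1 - p))).re =
        eigenSum (fun x z => x ^ p * z ^ (1 - p)) hA.isHermitian hZ.isHermitian K := by
    intro A Z hA hZ
    rw [CFC.rpow_eq_cfc_real hA.posSemidef.nonneg, CFC.rpow_eq_cfc_real hZ.posSemidef.nonneg,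
      trace_conjTranspose_mul_cfc_self hA.isHermitian hZ.isHermitian]
    rfl
  rw [key hA hZ, key hA₁ hZ₁, key hA₂ hZ₂]
  exact eigenSum_rpow_convex hp hp' hs ht K hA₁ hA₂ hZ₁ hZ₂ hA hZ

/-! ### Peierls' inequality and the case `r ≥ p` -/

lemma sum_norm_sq_row_of_unitary {U : Matrix ι ι ℂ} (hU : U * Uᴴ = 1) (i : ι) :
    ∑ j, ‖U i j‖ ^ 2 = 1 := by
  have h := congrFun (congrFun hU i) i
  rw [mul_apply, one_apply_eq] at h
  have h' := congrArg Complex.re h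
  rw [Complex.re_sum] at h'
  rw [← Complex.one_re, ← h']
  refine Finset.sum_congr rfl fun j _ => ?_
  rw [conjTranspose_apply, Complex.star_def, Complex.mul_conj, Complex.ofReal_re,
    Complex.normSq_eq_norm_sq]

lemma sum_norm_sq_col_of_unitary {U : Matrix ι ι ℂ} (hU : Uᴴ * U = 1) (j : ι) :
    ∑ i, ‖U i j‖ ^ 2 = 1 := by
  have h := sum_norm_sq_row_of_unitary (U := Uᴴ) (by rwa [conjTranspose_conjTranspose]) j
  simpa [conjTranspose_apply] using h

lemma re_diag_conj_eq_sum {N : Matrix ι ι ℂ} (hN : N.IsHermitian) (V : Matrix ι ι ℂ) (i : ι) :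
    ((Vᴴ * N * V) i i).re =
      ∑ j, ‖(Vᴴ * (hN.eigenvectorUnitary : Matrix ι ι ℂ)) i j‖ ^ 2 * hN.eigenvalues j := by
  have h : Vᴴ * N * V = (Vᴴ * (hN.eigenvectorUnitary : Matrix ι ι ℂ)) *
      (diagonal (fun i => (hN.eigenvalues i : ℂ)) *
        (Vᴴ * (hN.eigenvectorUnitary : Matrix ι ι ℂ))ᴴ) := by
    have e := hN.cfc_eq_mul id
    rw [cfc_id ℝ N hN.isSelfAdjoint] at e
    conv_lhs => rw [e]
    simp only [conjTranspose_mul, star_eq_conjTranspose, conjTranspose_conjTranspose, mul_assoc,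
      id]
  rw [h, mul_apply, Complex.re_sum]
  refine Finset.sum_congr rfl fun j _ => ?_
  rw [diagonal_mul, conjTranspose_apply, mul_left_comm, Complex.star_def, Complex.mul_conj,
    ← Complex.ofReal_mul, Complex.ofReal_re, Complex.normSq_eq_norm_sq, mul_comm]

/-- Peierls' inequality. -/
lemma sum_map_diag_le_sum_map_eigenvalues {N V : Matrix ι ι ℂ} (hN : N.PosSemidef)
    (hV : V ∈ unitary (Matrix ι ι ℂ)) {f : ℝ → ℝ} (hf : ConvexOn ℝ (Set.Ici 0) f) :
    ∑ i, f ((Vᴴ * N * V) i i).re ≤ ∑ j, f (hN.isHermitian.eigenvalues j) := by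
  set U := hN.isHermitian.eigenvectorUnitary
  have hV1 : Vᴴ * V = 1 := Unitary.star_mul_self_of_mem hV
  have hV2 : V * Vᴴ = 1 := Unitary.mul_star_self_of_mem hV
  have hU1 : (U : Matrix ι ι ℂ)ᴴ * (U : Matrix ι ι ℂ) = 1 := Unitary.star_mul_self_of_mem U.2
  have hU2 : (U : Matrix ι ι ℂ) * (U : Matrix ι ι ℂ)ᴴ = 1 := Unitary.mul_star_self_of_mem U.2
  -- The squared moduli of the entries of `Vᴴ U` are doubly stochastic: rows supply the Jensen
  -- weights, columns collapse the double sum.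
  have hr := sum_norm_sq_row_of_unitary (U := Vᴴ * (U : Matrix ι ι ℂ)) (by
    rw [conjTranspose_mul, conjTranspose_conjTranspose, mul_assoc, ← mul_assoc _ _ V, hU2,
      one_mul, hV1])
  have hc := sum_norm_sq_col_of_unitary (U := Vᴴ * (U : Matrix ι ι ℂ)) (by
    rw [conjTranspose_mul, conjTranspose_conjTranspose, mul_assoc, ← mul_assoc V, hV2,
      one_mul, hU1])
  calc ∑ i, f ((Vᴴ * N * V) i i).re
      ≤ ∑ i, ∑ j, ‖(Vᴴ * (U : Matrix ι ι ℂ)) i j‖ ^ 2 * f (hN.isHermitian.eigenvalues j) := by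
        refine Finset.sum_le_sum fun i _ => ?_
        rw [re_diag_conj_eq_sum hN.isHermitian]
        exact hf.map_sum_le (fun j _ => by positivity) (hr i) fun j _ => hN.eigenvalues_nonneg j
    _ = ∑ j, f (hN.isHermitian.eigenvalues j) := by
        rw [Finset.sum_comm]
        refine Finset.sum_congr rfl fun j _ => ?_
        rw [← Finset.sum_mul, hc j, one_mul]

lemma re_diag_conj_nonneg {κ : Type*} [Fintype κ] {N : Matrix κ κ ℂ} (hN : N.PosSemidef)
    (V : Matrix κ κ ℂ) (i : κ) :
    0 ≤ ((Vᴴ * N * V) i i).re :=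
  (Complex.le_def.1 (hN.conjTranspose_mul_mul_same V).diag_nonneg).1

/-- Let `V` diagonalise `M`, so that its eigenvalues are diagonal entries. Monotonicity and
convexity of `x ↦ x^c` bound their powers by those of the diagonals of `M₁` and `M₂`, and Peierls'
inequality returns to eigenvalues. -/
lemma trace_rpow_le_of_diag_le {M M₁ M₂ : Matrix ι ι ℂ} (hM : M.PosSemidef) (hM₁ : M₁.PosSemidef)
    (hM₂ : M₂.PosSemidef) {c s t : ℝ} (hc : 1 ≤ c) (hs : 0 ≤ s) (ht : 0 ≤ t) (hst : s + t = 1)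
    (h : ∀ V : Matrix ι ι ℂ, ∀ i, ((Vᴴ * M * V) i i).re ≤
      s * ((Vᴴ * M₁ * V) i i).re + t * ((Vᴴ * M₂ * V) i i).re) :
    (trace (M ^ c)).re ≤ s * (trace (M₁ ^ c)).re + t * (trace (M₂ ^ c)).re := by
  rw [CFC.rpow_eq_cfc_real hM.nonneg, CFC.rpow_eq_cfc_real hM₁.nonneg,
    CFC.rpow_eq_cfc_real hM₂.nonneg, trace_cfc hM.isHermitian, trace_cfc hM₁.isHermitian,
    trace_cfc hM₂.isHermitian]
  set V := hM.isHermitian.eigenvectorUnitary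
  have hf := convexOn_rpow hc
  have hd : ∀ i, hM.isHermitian.eigenvalues i =
      (((V : Matrix ι ι ℂ)ᴴ * M * (V : Matrix ι ι ℂ)) i i).re := by
    intro i
    rw [re_diag_conj_eq_sum hM.isHermitian]
    have : (V : Matrix ι ι ℂ)ᴴ * (V : Matrix ι ι ℂ) = 1 := Unitary.star_mul_self_of_mem V.2
    rw [this, Finset.sum_eq_single i]
    · simp
    · intro j _ hj
      simp [one_apply_ne hj.symm]
    · simp
  calc ∑ i, hM.isHermitian.eigenvalues i ^ c
      ≤ ∑ i, (s * (((V : Matrix ι ι ℂ)ᴴ * M₁ * (V : Matrix ι ι ℂ)) i i).re ^ c +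
          t * (((V : Matrix ι ι ℂ)ᴴ * M₂ * (V : Matrix ι ι ℂ)) i i).re ^ c) := by
        refine Finset.sum_le_sum fun i _ => ?_
        have h1 := re_diag_conj_nonneg hM₁ (V : Matrix ι ι ℂ) i
        have h2 := re_diag_conj_nonneg hM₂ (V : Matrix ι ι ℂ) i
        have h0 := hM.eigenvalues_nonneg i
        refine (Real.rpow_le_rpow h0 ?_ (by linarith)).trans (hf.2 h1 h2 hs ht hst)
        rw [hd i]
        exact h _ i
    _ ≤ _ := by
        rw [Finset.sum_add_distrib, ← Finset.mul_sum, ← Finset.mul_sum]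
        exact add_le_add
          (mul_le_mul_of_nonneg_left (sum_map_diag_le_sum_map_eigenvalues hM₁ V.2 hf) hs)
          (mul_le_mul_of_nonneg_left (sum_map_diag_le_sum_map_eigenvalues hM₂ V.2 hf) ht)

lemma PosDef.smul_add_smul {κ : Type*} {A₁ A₂ : Matrix κ κ ℂ} (hA₁ : A₁.PosDef)
    (hA₂ : A₂.PosDef) {s t : ℝ} (hs : 0 ≤ s) (ht : 0 ≤ t) (hst : s + t = 1) : (s • A₁ + t • A₂).PosDef := by
  rcases hs.eq_or_lt with rfl | hs
  · obtain rfl : t = 1 := by linarith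
    simpa using hA₂
  · exact (hA₁.smul hs).add_posSemidef (hA₂.posSemidef.smul ht)

lemma posSemidef_conj_rpow (A B : Matrix ι ι ℂ) (p : ℝ) : (Bᴴ * A ^ p * B).PosSemidef :=
  (nonneg_iff_posSemidef.1 CFC.rpow_nonneg).conjTranspose_mul_mul_same B

lemma trace_rpow_convex {A₁ A₂ : Matrix ι ι ℂ} (hA₁ : A₁.PosDef) (hA₂ : A₂.PosDef) {c s t : ℝ}
    (hc : 1 ≤ c) (hs : 0 ≤ s) (ht : 0 ≤ t) (hst : s + t = 1) :
    (trace ((s • A₁ + t • A₂) ^ c)).re ≤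
      s * (trace (A₁ ^ c)).re + t * (trace (A₂ ^ c)).re := by
  refine trace_rpow_le_of_diag_le (hA₁.smul_add_smul hA₂ hs ht hst).posSemidef hA₁.posSemidef
    hA₂.posSemidef hc hs ht hst fun V i => le_of_eq ?_
  simp only [mul_add, add_mul, mul_smul_comm, smul_mul_assoc, add_apply, smul_apply,
    Complex.add_re, Complex.smul_re, smul_eq_mul]

lemma trace_conj_rpow_convex_of_le {p c s t : ℝ} (hp : 1 < p) (hp' : p ≤ 2) (hc : 1 ≤ c)
    (hs : 0 ≤ s) (ht : 0 ≤ t) (hst : s + t = 1) (B : Matrix ι ι ℂ) {A₁ A₂ : Matrix ι ι ℂ}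
    (hA₁ : A₁.PosDef) (hA₂ : A₂.PosDef) :
    (trace ((Bᴴ * (s • A₁ + t • A₂) ^ p * B) ^ c)).re ≤
      s * (trace ((Bᴴ * A₁ ^ p * B) ^ c)).re + t * (trace ((Bᴴ * A₂ ^ p * B) ^ c)).re := by
  refine trace_rpow_le_of_diag_le (posSemidef_conj_rpow _ _ _) (posSemidef_conj_rpow _ _ _)
    (posSemidef_conj_rpow _ _ _) hc hs ht hst fun V i => ?_
  -- With `Z = 1`, the matrix unit in `K` makes the trace pick out one diagonal entry.
  have h := trace_rpow_mul_rpow_convex hp hp' hs ht (B * V * single i i 1) hA₁ hA₂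
    PosDef.one PosDef.one (hA₁.smul_add_smul hA₂ hs ht hst)
    (PosDef.one.smul_add_smul PosDef.one hs ht hst)
  have e : ∀ N : Matrix ι ι ℂ, trace ((B * V * single i i 1)ᴴ * N * (B * V * single i i 1)) =
      (Vᴴ * (Bᴴ * N * B) * V) i i := by
    intro N
    rw [conjTranspose_mul, conjTranspose_mul, conjTranspose_single, star_one, ← mul_assoc,
      trace_mul_comm]
    simp only [mul_assoc]
    rw [← mul_assoc (single i i (1 : ℂ)), single_mul_single_same, mul_one, trace_single_mul]
    simp
  rwa [← add_smul, hst, one_smul, CFC.one_rpow, mul_one, mul_one, mul_one, e, e, e] at h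

/-! ### Young's variational formula and the case `r < p` -/

/-- Young's inequality under the trace. -/
lemma trace_rpow_le_young {X Z : Matrix ι ι ℂ} (hX : X.PosSemidef) (hZ : Z.PosDef) {σ q c : ℝ}
    (hσ : 0 < σ) (hσ' : σ < 1) (hc : c * (1 - σ) = q * σ) :
    (trace (X ^ σ)).re ≤ σ * (trace (X * Z ^ (-q))).re + (1 - σ) * (trace (Z ^ c)).re := by
  have hX' := hX.isHermitian.isSelfAdjoint
  have hZ' := hZ.isHermitian.isSelfAdjoint
  -- With `K = 1` all three traces carry the same weights, leaving a scalar inequality for each pair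
  -- of eigenvalues.
  have e1 := trace_conjTranspose_mul_cfc_self hX.isHermitian hZ.isHermitian 1
    (fun x => x ^ σ) (fun _ => 1)
  have e2 := trace_conjTranspose_mul_cfc_self hX.isHermitian hZ.isHermitian 1
    id (fun x => x ^ (-q))
  have e3 := trace_conjTranspose_mul_cfc_self hX.isHermitian hZ.isHermitian 1
    (fun _ => 1) (fun x => x ^ c)
  rw [conjTranspose_one, one_mul, mul_one] at e1 e2 e3
  rw [cfc_const_one ℝ Z hZ', mul_one, ← CFC.rpow_eq_cfc_real hX.nonneg] at e1
  rw [cfc_id ℝ X hX', ← CFC.rpow_eq_cfc_real hZ.posSemidef.nonneg] at e2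
  rw [cfc_const_one ℝ X hX', one_mul, ← CFC.rpow_eq_cfc_real hZ.posSemidef.nonneg] at e3
  rw [e1, e2, e3, Finset.mul_sum, Finset.mul_sum, ← Finset.sum_add_distrib]
  refine Finset.sum_le_sum fun i _ => ?_
  rw [Finset.mul_sum, Finset.mul_sum, ← Finset.sum_add_distrib]
  refine Finset.sum_le_sum fun j _ => ?_
  have hx := hX.eigenvalues_nonneg i
  have hz := hZ.eigenvalues_pos j
  set x := hX.isHermitian.eigenvalues i
  set z := hZ.isHermitian.eigenvalues j
  have h := Real.geom_mean_le_arith_mean2_weighted hσ.le (by linarith : 0 ≤ 1 - σ)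
    (mul_nonneg hx (Real.rpow_nonneg hz.le (-q))) (Real.rpow_nonneg hz.le c) (by ring)
  -- By `hc` the powers of `z` cancel in the geometric mean, leaving `x^σ`.
  rw [Real.mul_rpow hx (Real.rpow_nonneg hz.le _), ← Real.rpow_mul hz.le, ← Real.rpow_mul hz.le,
    mul_assoc, ← Real.rpow_add hz, hc, neg_mul, neg_add_cancel, Real.rpow_zero, mul_one] at h
  calc _ = ‖eigenCoeff hX.isHermitian hZ.isHermitian 1 i j‖ ^ 2 * x ^ σ := by ring
    _ ≤ ‖eigenCoeff hX.isHermitian hZ.isHermitian 1 i j‖ ^ 2 *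
        (σ * (x * z ^ (-q)) + (1 - σ) * z ^ c) := by gcongr
    _ = _ := by simp only [id]; ring

lemma posDef_cfc {X : Matrix ι ι ℂ} (hX : X.PosSemidef) {f : ℝ → ℝ} (hf : ∀ x, 0 ≤ x → 0 < f x) :
    (cfc f X).PosDef := by
  have hH : (cfc f X).IsHermitian := cfc_predicate f X
  rw [hH.posDef_iff_eigenvalues_pos]
  intro i
  have h := hH.eigenvalues_mem_spectrum_real i
  rw [cfc_map_spectrum f X
    (ha := hX.isHermitian.isSelfAdjoint) (hf := X.finite_real_spectrum.continuousOn f)] at h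
  obtain ⟨x, hx, hxi⟩ := h
  rw [hX.isHermitian.spectrum_real_eq_range_eigenvalues] at hx
  obtain ⟨j, rfl⟩ := hx
  rw [← hxi]
  exact hf _ (hX.eigenvalues_nonneg j)

lemma rpow_cfc {X : Matrix ι ι ℂ} (hX : X.PosSemidef) {f : ℝ → ℝ} (hf : ∀ x, 0 ≤ x → 0 < f x)
    (y : ℝ) : cfc f X ^ y = cfc (fun x => f x ^ y) X := by
  rw [CFC.rpow_eq_cfc_real (posDef_cfc hX hf).posSemidef.nonneg]
  exact (cfc_comp' _ f X ((X.finite_real_spectrum.image f).continuousOn _)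
    (X.finite_real_spectrum.continuousOn f) hX.isHermitian.isSelfAdjoint).symm

/-- Equality in Young's inequality wants `Z = X^(σ/c)`, which is singular when `X` is. Replacing `X`
by `X + ε` keeps `Z` positive definite and costs only `x ≤ x + ε`. -/
lemma exists_posDef_young_le {X : Matrix ι ι ℂ} (hX : X.PosSemidef) {σ q c ε : ℝ}
    (hσ : 0 < σ) (hσ' : σ < 1) (hq : 0 < q) (hc : c * (1 - σ) = q * σ) (hε : 0 < ε) :
    ∃ Z : Matrix ι ι ℂ, Z.PosDef ∧
      σ * (trace (X * Z ^ (-q))).re + (1 - σ) * (trace (Z ^ c)).re ≤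
        ∑ i, (hX.isHermitian.eigenvalues i + ε) ^ σ := by
  have hf : ∀ x : ℝ, 0 ≤ x → 0 < (x + ε) ^ (σ / c) := fun x hx => by positivity
  have hc0 : 0 < c := by
    have : 0 < c * (1 - σ) := hc ▸ mul_pos hq hσ
    exact pos_of_mul_pos_left this (by linarith)
  refine ⟨cfc (fun x => (x + ε) ^ (σ / c)) X, posDef_cfc hX hf, ?_⟩
  have e : X * cfc (fun x => ((x + ε) ^ (σ / c)) ^ (-q)) X =
      cfc (fun x => x * ((x + ε) ^ (σ / c)) ^ (-q)) X := by
    rw [cfc_mul (fun x => x) _ X (X.finite_real_spectrum.continuousOn _)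
      (X.finite_real_spectrum.continuousOn _), cfc_id' ℝ X hX.isHermitian.isSelfAdjoint]
  rw [rpow_cfc hX hf, rpow_cfc hX hf, e, trace_cfc hX.isHermitian, trace_cfc hX.isHermitian,
    Finset.mul_sum, Finset.mul_sum, ← Finset.sum_add_distrib]
  refine Finset.sum_le_sum fun i _ => ?_
  have hx := hX.eigenvalues_nonneg i
  set x := hX.isHermitian.eigenvalues i
  have hxe : 0 < x + ε := by positivity
  have h1 : σ / c * -q = σ - 1 := by
    field_simp
    linarith
  have h2 : σ / c * c = σ := by field_simp
  rw [← Real.rpow_mul hxe.le, ← Real.rpow_mul hxe.le, h1, h2]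
  have h3 : x * (x + ε) ^ (σ - 1) ≤ (x + ε) ^ σ := by
    calc x * (x + ε) ^ (σ - 1) ≤ (x + ε) * (x + ε) ^ (σ - 1) := by gcongr; linarith
      _ = (x + ε) ^ σ := by rw [Real.rpow_sub_one hxe.ne']; field_simp
  nlinarith

lemma trace_conj_rpow_convex_of_lt {p r s t : ℝ} (hp : 1 < p) (hp' : p ≤ 2) (hr : 1 ≤ r)
    (hrp : r < p) (hs : 0 ≤ s) (ht : 0 ≤ t) (hst : s + t = 1) (B : Matrix ι ι ℂ)
    {A₁ A₂ : Matrix ι ι ℂ} (hA₁ : A₁.PosDef) (hA₂ : A₂.PosDef) :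
    (trace ((Bᴴ * (s • A₁ + t • A₂) ^ p * B) ^ (r / p))).re ≤
      s * (trace ((Bᴴ * A₁ ^ p * B) ^ (r / p))).re +
      t * (trace ((Bᴴ * A₂ ^ p * B) ^ (r / p))).re := by
  have hp0 : 0 < p := by linarith
  have hpr : 0 < p - r := by linarith
  have hσ : 0 < r / p := by positivity
  have hσ' : r / p < 1 := by rwa [div_lt_one hp0]
  have hq : 0 < p - 1 := by linarith
  -- The exponent forced by the balance condition `hc` with `q = p - 1`; here `c ≥ 1` amounts to `r
  -- ≥ 1`.
  set c := r * (p - 1) / (p - r) with hc_def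
  have hc : c * (1 - r / p) = (p - 1) * (r / p) := by
    rw [hc_def]
    field_simp
  have hc1 : 1 ≤ c := by
    rw [hc_def, le_div_iff₀ hpr]
    nlinarith
  have hX₁ := posSemidef_conj_rpow A₁ B p
  have hX₂ := posSemidef_conj_rpow A₂ B p
  have key : ∀ ε : ℝ, 0 < ε → (trace ((Bᴴ * (s • A₁ + t • A₂) ^ p * B) ^ (r / p))).re ≤
      s * ∑ i, (hX₁.isHermitian.eigenvalues i + ε) ^ (r / p) +
      t * ∑ i, (hX₂.isHermitian.eigenvalues i + ε) ^ (r / p) := by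
    intro ε hε
    obtain ⟨Z₁, hZ₁, h₁⟩ := exists_posDef_young_le hX₁ hσ hσ' hq hc hε
    obtain ⟨Z₂, hZ₂, h₂⟩ := exists_posDef_young_le hX₂ hσ hσ' hq hc hε
    -- The combination of the two near-minimisers is a competitor for the combination of `A₁` and
    -- `A₂`.
    have hZ := hZ₁.smul_add_smul hZ₂ hs ht hst
    have hA := hA₁.smul_add_smul hA₂ hs ht hst
    have hy := trace_rpow_le_young (posSemidef_conj_rpow (s • A₁ + t • A₂) B p) hZ hσ hσ' hc
    have hj := trace_rpow_mul_rpow_convex hp hp' hs ht B hA₁ hA₂ hZ₁ hZ₂ hA hZ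
    have hz := trace_rpow_convex hZ₁ hZ₂ hc1 hs ht hst
    rw [neg_sub] at hy h₁ h₂
    have hj' := mul_le_mul_of_nonneg_left hj hσ.le
    have hz' := mul_le_mul_of_nonneg_left hz (by linarith : 0 ≤ 1 - r / p)
    have h₁' := mul_le_mul_of_nonneg_left h₁ hs
    have h₂' := mul_le_mul_of_nonneg_left h₂ ht
    linarith
  rw [CFC.rpow_eq_cfc_real hX₁.nonneg, CFC.rpow_eq_cfc_real hX₂.nonneg,
    trace_cfc hX₁.isHermitian, trace_cfc hX₂.isHermitian]
  -- Let `ε → 0`; the positive exponent gives continuity even at a zero eigenvalue.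
  have hlim : ∀ {X : Matrix ι ι ℂ} (hX : X.IsHermitian),
      Filter.Tendsto (fun ε : ℝ => ∑ i, (hX.eigenvalues i + ε) ^ (r / p))
        (nhdsWithin 0 (Set.Ioi 0)) (nhds (∑ i, hX.eigenvalues i ^ (r / p))) := by
    intro X hX
    refine tendsto_finsetSum _ fun i _ => ?_
    have hcont : Continuous fun ε : ℝ => (hX.eigenvalues i + ε) ^ (r / p) :=
      (continuous_const.add continuous_id).rpow_const fun _ => Or.inr hσ.le
    have h := hcont.tendsto 0
    rw [add_zero] at h
    exact h.mono_left nhdsWithin_le_nhds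
  exact ge_of_tendsto (((hlim hX₁.isHermitian).const_mul s).add
    ((hlim hX₂.isHermitian).const_mul t)) (Filter.eventually_of_mem self_mem_nhdsWithin key)

lemma convex_setOf_posDef {κ : Type*} : Convex ℝ {A : Matrix κ κ ℂ | A.PosDef} :=
  fun _ hA₁ _ hA₂ _ _ hs ht hst => PosDef.smul_add_smul hA₁ hA₂ hs ht hst

end Matrix

/-- Powers `X ^ (t : ℝ)` of a positive semidefinite matrix are Mathlib's real powers of the
continuous functional calculus (apply `x ↦ x ^ t` to the eigenvalues). The matrix inside the trace
is positive semidefinite, so its trace is real and `.re` only changes the type to `ℝ`. -/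
theorem corollary4p6 (n : ℕ) (p r : ℝ) (hp₁ : 1 < p) (hp₂ : p ≤ 2) (hr : 1 ≤ r)
    (B : Matrix (Fin n) (Fin n) ℂ) :
    ConvexOn ℝ {A : Matrix (Fin n) (Fin n) ℂ | A.PosDef}
      (fun A : Matrix (Fin n) (Fin n) ℂ =>
        (Matrix.trace ((B.conjTranspose * A ^ p * B) ^ (r / p))).re) := by
  refine ⟨Matrix.convex_setOf_posDef, fun A₁ hA₁ A₂ hA₂ s t hs ht hst => ?_⟩
  rcases lt_or_ge r p with h | h
  · exact Matrix.trace_conj_rpow_convex_of_lt hp₁ hp₂ hr h hs ht hst B hA₁ hA₂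
  · exact Matrix.trace_conj_rpow_convex_of_le hp₁ hp₂ ((one_le_div (by linarith)).2 h) hs ht hst B
      hA₁ hA₂
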